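/- **Normal o-graphs.** A normal o-graph is an oriented virtual link diagram, up to planar isotopy and virtual Reidemeister (detour) moves, in which every component meets a real crossing. Equivalently, it is a finite set $V$ of real crossings, each with a sign $\pm1$, together with a permutation of the passages $V\times\{O,U\}$ (over and under passages) which sends each passage to the next one met along the orientation; isomorphic data are identified. An edge is an arc between two consecutive passages. Normal o-graphs represent branched standard polyhedra: the connected ones correspond to the polyhedra up to homeomorphism. They are not required to be closed, i.e. to represent closed $3$-manifolds. **Circuits.** Along each edge draw three parallel lines, numbered $1,2,3$ from left to right when the edge points upwards. At a crossing let $u_L,u_R$ be the halves of the under strand to the left and right of the over strand, and $o_L,o_R$ the halves of the over strand to the left and right of the under strand. (At a positive crossing $u_R,o_L$ are incoming and $u_L,o_R$ outgoing; at a negative crossing the reverse.) Writing $e^k$ for the $k$-th line of $e$, join $$u_L^1 - u_R^1,\quad u_L^3 - o_R^1,\quad u_R^3 - o_R^3,\quad u_L^2 - o_L^1,\quad u_R^2 - o_L^3,\quad o_R^2 - o_L^2 .$$ The resulting circuits are the boundaries of the $2$-cells of the polyhedron. **Pure sliding moves.** A pure sliding move takes two disjoint arcs of edges (possibly of the same edge),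 called left and right, and makes them cross in a pair of crossings of opposite signs (Reidemeister II). The following conditions refer to the circuits of the whole normal o-graph before the move. * ps-I: the left arc passes over the right one, arcs parallel, both meeting first the positive and then the negative crossing. Condition (PS-I): line $3$ on the left and line $2$ on the right lie on the same circuit. * ps-II: the left arc passes under the right one, arcs parallel, both meeting first the negative and then the positive crossing. Condition (PS-II): line $3$ on the left, line $1$ on the right. * ps-III: the left arc passes over the right one, arcs antiparallel; the left arc meets first the positive crossing, the right arc first the negative one. Condition (PS-III): line $1$ on the left, line $2$ on the right. * ps-IV: the left arc passes over the right one, arcs antiparallel; the left arc meets first the negative crossing, the right arc first the positive one. Condition (PS-IV): line $3$ on the left, line $3$ on the right. **MP moves.** Each replaces a local picture of three strands with crossings $x,y$ by one of the same three strands (same endpoints) with crossings $a,b,c$. Strands are given as the words of passages met along them, written "strand 0; strand 1; strand 2". * Shape A: $U_x;\ O_yO_x;\ U_y$ with signs $x,y=+,+$ becomes $U_bU_c;\ O_a;\ O_bU_aO_c$ with signs $a,b,c=+,+,-$. * Shape B: shape A with every crossing changed ($O\leftrightarrow U$ and all signs reversed). * Shape C: $U_x;\ U_yO_x;\ O_y$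 with signs $-,-$ becomes $U_cU_b;\ O_cU_a;\ O_bO_a$ with signs $-,-,-$. * Shape D: $U_x;\ O_xU_y;\ O_y$ with signs $+,+$ becomes $U_bU_c;\ U_aO_c;\ O_aO_b$ with signs $+,+,+$. In each shape two strands may be reversed, in the same way before and after the move. Reversing a strand reverses its word and changes the sign of each crossing between it and another strand. The 16 MP moves are: A1, A2, A3, A4 (respectively B1–B4), obtained from shape A (respectively B) by reversing no strand, strand $0$, strand $1$, both strands $0$ and $1$; and C1, C2, C3, C4 (respectively D1–D4), obtained from shape C (respectively D) by reversing strand $0$, no strand, both strands $0$ and $2$, strand $2$. The primary MP move is: $O_y;\ O_xU_y;\ U_x$ with signs $+,+$ becomes $O_aO_b;\ U_aO_c;\ U_bU_c$ with signs $+,+,+$. It resembles a Reidemeister III move with positive crossings, except that one of the three crossings is virtual before the move. It is D2 with its strands listed in the opposite order. **Theorem.** Each of the 16 MP moves is a sequence of primary MP moves, pure sliding moves ps-I–ps-IV (each subject to its condition), and inverses of these. That is, for each of the 16 types there is a finite word in the five generating moves and their inverses such that, whenever an arbitrary normal o-graph $\Gamma'$ is obtained from a normal o-graph $\Gamma$ by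 an MP move of that type, there is a sequence of normal o-graphs from $\Gamma$ to $\Gamma'$ whose successive terms are related by the successive letters of the word. If $\Gamma$ is connected, all terms can be taken connected. -/

import Mathlib

/-- The over strand (`upper`) and the under strand (`lower`) of a real crossing. -/
inductive Level
  | upper
  | lower

/-- The underlying object of an oriented virtual link diagram up to planar isotopy and the virtual
Reidemeister (detour) moves, with at least one real crossing on every component: its signed
oriented Gauss diagram.

`V` is the set of real crossings (true vertices) and `sign` their signs. A passage through a
crossing is a pair `(v, s)`: the over strand or the under strand of `v`. Following the orientation
of the diagram from the passage `p`, the next real crossing is met in the passage `next p`.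
Equality of diagrams is isomorphism of this data; all moves below are invariant under it.
Connectedness is a separate predicate, `IsConnected`. -/
structure NormalOGraph where
  V : Type
  finite_V : Finite V
  sign : V → ℤˣ
  next : Equiv.Perm (V × Level)

namespace NormalOGraph

/-- An edge is named by the passage it leaves; the edge `e` runs from `e` to `next e`. -/
abbrev Edge (Γ : NormalOGraph) : Type := Γ.V × Level

/-- The underlying 4-valent graph is nonempty and connected. -/
def IsConnected (Γ : NormalOGraph) : Prop :=
  Nonempty Γ.V ∧
    ∀ v w : Γ.V, Relation.EqvGen (fun a b => ∃ s t : Level, Γ.next (a, s) = (b, t)) v w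

/-! ### The circuit diagram (boundaries of the 2-cells) -/

/-- The edge arriving at `v` along the strand `s`. -/
def inEdge (Γ : NormalOGraph) (v : Γ.V) (s : Level) : Γ.Edge := Γ.next.symm (v, s)

/-- The edge leaving `v` along the strand `s`. -/
def outEdge (Γ : NormalOGraph) (v : Γ.V) (s : Level) : Γ.Edge := (v, s)

/-- The half of the under strand at `v` that lies to the left of the over strand. At a positive
crossing the under strand passes from the right to the left of the over strand. -/
def underLeft (Γ : NormalOGraph) (v : Γ.V) : Γ.Edge :=
  if Γ.sign v = 1 then Γ.outEdge v .lower else Γ.inEdge v .lower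

/-- The half of the under strand at `v` that lies to the right of the over strand. -/
def underRight (Γ : NormalOGraph) (v : Γ.V) : Γ.Edge :=
  if Γ.sign v = 1 then Γ.inEdge v .lower else Γ.outEdge v .lower

/-- The half of the over strand at `v` that lies to the left of the under strand. At a positive
crossing the over strand passes from the left to the right of the under strand. -/
def overLeft (Γ : NormalOGraph) (v : Γ.V) : Γ.Edge :=
  if Γ.sign v = 1 then Γ.inEdge v .upper else Γ.outEdge v .upper

/-- The half of the over strand at `v` that lies to the right of the under strand. -/
def overRight (Γ : NormalOGraph) (v : Γ.V) : Γ.Edge :=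
  if Γ.sign v = 1 then Γ.outEdge v .upper else Γ.inEdge v .upper

/-- The three parallel lines of the circuit diagram along each edge, numbered from left to right
when the edge points upwards: `0` is the first line (lower sheet on the left), `1` the second
(upper sheet on the left), `2` the third (the single sheet on the right). -/
abbrev Line (Γ : NormalOGraph) : Type := Γ.Edge × Fin 3

/-- How the lines of the four edge ends at a crossing are joined there. With the butterfly at a true
vertex seen as a horizontal stack of four chambers `0 < 1 < 2 < 3`, where chamber `1` lies over the
left of the under strand and chamber `2` over the left of the over strand, the six clauses are the
six 2-cell corners `01, 02, 03, 12, 13, 23`, the corner `ij` separating the chambers `i` and `j`. -/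
inductive Joined (Γ : NormalOGraph) : Γ.Line → Γ.Line → Prop
  | c01 (v : Γ.V) : Joined Γ (Γ.underLeft v, 0) (Γ.underRight v, 0)
  | c02 (v : Γ.V) : Joined Γ (Γ.underLeft v, 2) (Γ.overRight v, 0)
  | c03 (v : Γ.V) : Joined Γ (Γ.underRight v, 2) (Γ.overRight v, 2)
  | c12 (v : Γ.V) : Joined Γ (Γ.underLeft v, 1) (Γ.overLeft v, 0)
  | c13 (v : Γ.V) : Joined Γ (Γ.underRight v, 1) (Γ.overLeft v, 2)
  | c23 (v : Γ.V) : Joined Γ (Γ.overRight v, 1) (Γ.overLeft v, 1)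

/-- Two lines belong to the same circuit, i.e. run along the boundary of the same 2-cell. -/
def SameCircuit (Γ : NormalOGraph) : Γ.Line → Γ.Line → Prop :=
  Relation.EqvGen Γ.Joined

/-- The passages of `l` are met consecutively when following the orientation of `Γ`. -/
def Consecutive (Γ : NormalOGraph) (l : List (Γ.V × Level)) : Prop :=
  List.IsChain (fun p q => Γ.next p = q) l

end NormalOGraph

/-! ### Local pictures -/

/-- A local picture with `n` oriented strands and `c` real crossings (virtual crossings are not
recorded): the signs of the crossings and the passages met along each strand. -/
structure Picture (n c : ℕ) where
  sign : Fin c → ℤˣ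
  strand : Fin n → List (Fin c × Level)

/-- The same planar picture with the orientation of the strand `k` reversed: the crossings of `k`
with the other strands change their sign. -/
def Picture.reverse {n c : ℕ} (D : Picture n c) (k : Fin n) : Picture n c where
  sign i := (-1) ^ (D.strand k).countP (fun p => p.1 = i) * D.sign i
  strand := Function.update D.strand k (D.strand k).reverse

/-- A replacement of a 3-strand picture with two crossings by one with three crossings; the
`k`-th strand has the same endpoints before and after. -/
structure LocalMove where
  before : Picture 3 2
  after : Picture 3 3

/-- The move with the orientation of the strand `k` reversed on both sides. -/
def LocalMove.reverse (M : LocalMove) (k : Fin 3) : LocalMove :=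
  ⟨M.before.reverse k, M.after.reverse k⟩

/-- `Γ` is obtained by placing the picture `D` (all of whose strands pass through a crossing) in an
exterior with crossings `W` and signs `σ`. The permutation `ctx` describes the exterior, the
strands of `D` being considered as bivalent points of it: it sends an exterior passage, or the end
of a strand of `D`, to the exterior passage, or the beginning of a strand of `D`, which follows. -/
def NormalOGraph.Realizes (Γ : NormalOGraph) {n c : ℕ} (D : Picture n c) {W : Type}
    (σ : W → ℤˣ) (ctx : Equiv.Perm ((W × Level) ⊕ Fin n)) : Prop :=
  ∃ f : W ⊕ Fin c ≃ Γ.V,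
    (∀ w, Γ.sign (f (.inl w)) = σ w) ∧
    (∀ i, Γ.sign (f (.inr i)) = D.sign i) ∧
    let passages : (W × Level) ⊕ Fin n → List (Γ.V × Level) :=
      Sum.elim (fun p => [(f (.inl p.1), p.2)])
        (fun k => (D.strand k).map fun p => (f (.inr p.1), p.2))
    ∀ x, Γ.Consecutive (passages x ++ passages (ctx x))

/-- `Γ'` is obtained from `Γ` by replacing an occurrence of `M.before` by `M.after`. -/
def LocalMove.Rel (M : LocalMove) (Γ Γ' : NormalOGraph) : Prop :=
  ∃ (W : Type) (σ : W → ℤˣ) (ctx : Equiv.Perm ((W × Level) ⊕ Fin 3)),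
    Γ.Realizes M.before σ ctx ∧ Γ'.Realizes M.after σ ctx

/-! ### The 16 MP moves and the primary MP move -/

open Level in
/-- The picture of type A: the strand `1` crosses over the strands `0` and `2`. -/
def shapeA : LocalMove where
  before := ⟨![1, 1], ![[(0, lower)], [(1, upper), (0, upper)], [(1, lower)]]⟩
  after := ⟨![1, 1, -1],
    ![[(1, lower), (2, lower)], [(0, upper)], [(1, upper), (0, lower), (2, upper)]]⟩

open Level in
/-- The picture of type B: the picture of type A with every crossing changed. -/
def shapeB : LocalMove where
  before := ⟨![-1, -1], ![[(0, upper)], [(1, lower), (0, lower)], [(1, upper)]]⟩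
  after := ⟨![-1, -1, 1],
    ![[(1, upper), (2, upper)], [(0, lower)], [(1, lower), (0, upper), (2, lower)]]⟩

open Level in
/-- The picture of type C: the strand `0` is below the strand `1`, which is below the strand `2`.
On the left the strands `0` and `2` cross virtually; along the strand `1`, the crossing with the
strand `2` comes first on the left and last on the right. -/
def shapeC : LocalMove where
  before := ⟨![-1, -1], ![[(0, lower)], [(1, lower), (0, upper)], [(1, upper)]]⟩
  after := ⟨![-1, -1, -1],
    ![[(2, lower), (1, lower)], [(2, upper), (0, lower)], [(1, upper), (0, upper)]]⟩

open Level in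
/-- The picture of type D: as in type C, with the strand `1` running in the opposite order and all
crossings positive. -/
def shapeD : LocalMove where
  before := ⟨![1, 1], ![[(0, lower)], [(0, upper), (1, lower)], [(1, upper)]]⟩
  after := ⟨![1, 1, 1],
    ![[(1, lower), (2, lower)], [(0, lower), (2, upper)], [(0, upper), (1, upper)]]⟩

/-- The names of the 16 MP moves. -/
inductive MPType
  | A1 | A2 | A3 | A4
  | B1 | B2 | B3 | B4
  | C1 | C2 | C3 | C4
  | D1 | D2 | D3 | D4

/-- The 16 MP moves. In each of the four pictures two strands have arbitrary orientation (the same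
one before and after the move): the strands `0` and `1` in the types A and B, the strands `0` and
`2` in the types C and D. -/
def MPType.move : MPType → LocalMove
  | A1 => shapeA
  | A2 => shapeA.reverse 0
  | A3 => shapeA.reverse 1
  | A4 => (shapeA.reverse 0).reverse 1
  | B1 => shapeB
  | B2 => shapeB.reverse 0
  | B3 => shapeB.reverse 1
  | B4 => (shapeB.reverse 0).reverse 1
  | C1 => shapeC.reverse 0
  | C2 => shapeC
  | C3 => (shapeC.reverse 0).reverse 2
  | C4 => shapeC.reverse 2
  | D1 => shapeD.reverse 0
  | D2 => shapeD
  | D3 => (shapeD.reverse 0).reverse 2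
  | D4 => shapeD.reverse 2

open Level in
/-- The primary MP move. Like a Reidemeister III move with three positive crossings, the strand `0`
passing over the strand `1` and both over the strand `2`, except that before the move the
crossing of the strands `0` and `2` is virtual. With `S i j` the crossing of the strand `i` over
the strand `j`, this is the pentagon relation `S 1 2 * S 0 1 = S 0 1 * S 0 2 * S 1 2`. -/
def primaryMP : LocalMove where
  before := ⟨![1, 1], ![[(1, upper)], [(0, upper), (1, lower)], [(0, lower)]]⟩
  after := ⟨![1, 1, 1],
    ![[(0, upper), (1, upper)], [(0, lower), (2, upper)], [(1, lower), (2, lower)]]⟩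

/-! ### The pure sliding moves -/

/-- The names of the four pure sliding moves. -/
inductive PSType
  | I | II | III | IV

open Level in
/-- The result of the move: two strands in Reidemeister II position, the strand `0` being the left
one and the strand `1` the right one. They are parallel in I and II, antiparallel in III and IV. -/
def PSType.picture : PSType → Picture 2 2
  | I => ⟨![1, -1], ![[(0, upper), (1, upper)], [(0, lower), (1, lower)]]⟩
  | II => ⟨![-1, 1], ![[(0, lower), (1, lower)], [(0, upper), (1, upper)]]⟩
  | III => ⟨![1, -1], ![[(0, upper), (1, upper)], [(1, lower), (0, lower)]]⟩
  | IV => ⟨![-1, 1], ![[(0, upper), (1, upper)], [(1, lower), (0, lower)]]⟩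

/-- The line of the left edge and the line of the right edge that have to be connected. The lines
are numbered from `0`, so that `2` is the third line. -/
def PSType.lines : PSType → Fin 3 × Fin 3
  | I => (2, 1)
  | II => (2, 0)
  | III => (0, 1)
  | IV => (2, 2)

open scoped Classical in
/-- `Γ'` is obtained from `Γ` by the pure sliding move `t` on an arc of the edge `a` (on the left)
and an arc of the edge `b` (on the right). If `a = b`, these are two disjoint arcs of one edge, in
either order. The condition on the circuit diagram is the one of `Γ`, before the move. -/
def PSType.Rel (t : PSType) (Γ Γ' : NormalOGraph) : Prop :=
  ∃ a b : Γ.Edge, Γ.SameCircuit (a, t.lines.1) (b, t.lines.2) ∧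
    ∃ f : Γ.V ⊕ Fin 2 ≃ Γ'.V,
      (∀ v, Γ'.sign (f (.inl v)) = Γ.sign v) ∧
      (∀ i, Γ'.sign (f (.inr i)) = t.picture.sign i) ∧
      let old : Γ.V × Level → Γ'.V × Level := fun p => (f (.inl p.1), p.2)
      let new : Fin 2 → List (Γ'.V × Level) := fun k =>
        (t.picture.strand k).map fun p => (f (.inr p.1), p.2)
      let onLeft : Γ.Edge → List (Γ'.V × Level) := fun e => if e = a then new 0 else []
      let onRight : Γ.Edge → List (Γ'.V × Level) := fun e => if e = b then new 1 else []
      (∀ e, Γ'.Consecutive ([old e] ++ onLeft e ++ onRight e ++ [old (Γ.next e)])) ∨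
      (∀ e, Γ'.Consecutive ([old e] ++ onRight e ++ onLeft e ++ [old (Γ.next e)]))

/-! ### Sequences of moves -/

/-- The generating moves: the primary MP move and the four pure sliding moves. -/
inductive Generator
  | primary
  | slide (t : PSType)

def Generator.Rel : Generator → NormalOGraph → NormalOGraph → Prop
  | primary => primaryMP.Rel
  | slide t => t.Rel

/-- A generating move or the inverse of one. -/
inductive Step
  | forward (g : Generator)
  | inverse (g : Generator)

def Step.Rel : Step → NormalOGraph → NormalOGraph → Prop
  | forward g, Γ, Γ' => g.Rel Γ Γ'
  | inverse g, Γ, Γ' => g.Rel Γ' Γ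

/-!
A picture is considered in an arbitrary exterior, that is, as a part of an unknown diagram. If two
pictures differ by a move of strands inside them, then so do all diagrams that arise from them by
adding the same exterior; hence it is enough to derive each MP move between two concrete pictures of
three strands.

The move D2 is the primary move with its strands listed in another order. Each of the other moves is
a pure sliding move followed either by the inverse of a move that has been derived before, or by
such a move and an inverse pure sliding move. The condition of the sliding move only depends on the
picture: the two lines that have to be on the same circuit are connected by a corner of the circuit,
a line of an edge within the picture, and a second corner.

Every generating move preserves connectedness. For the primary move, the picture can be collapsed to
a point before and after it. A pure sliding move puts two crossings on two edges that share a
circuit, so that they belong to one component even before the move.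
-/

/-! ### Words following each other along a permutation -/

/-- A partition of an alphabet into nonempty words: every letter occurs in exactly one of the words,
and only once. -/
structure IsPartition {ι α : Type*} (L : ι → List α) : Prop where
  ne_nil : ∀ i, L i ≠ []
  nodup : ∀ i, (L i).Nodup
  existsUnique_mem : ∀ a, ∃! i, a ∈ L i

instance {ι α : Type*} [Fintype ι] [DecidableEq ι] [Fintype α] [DecidableEq α] (L : ι → List α) :
    Decidable (IsPartition L) :=
  decidable_of_iff
    ((∀ i, L i ≠ []) ∧ (∀ i, (L i).Nodup) ∧ ∀ a, ∃ i, a ∈ L i ∧ ∀ j, a ∈ L j → j = i)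
    ⟨fun ⟨h₁, h₂, h₃⟩ => ⟨h₁, h₂, h₃⟩, fun ⟨h₁, h₂, h₃⟩ => ⟨h₁, h₂, h₃⟩⟩

namespace IsPartition

variable {ι α : Type*} {L : ι → List α}

theorem eq_of_mem (hL : IsPartition L) {i j : ι} {a : α} (hi : a ∈ L i) (hj : a ∈ L j) : i = j :=
  (hL.existsUnique_mem a).unique hi hj

theorem bijective_getElem (hL : IsPartition L) :
    Function.Bijective fun x : Σ i, Fin (L i).length => (L x.1)[x.2] := by
  constructor
  · rintro ⟨i, j⟩ ⟨i', j'⟩ (h : (L i)[j] = (L i')[j'])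
    obtain rfl : i = i' := hL.eq_of_mem (List.getElem_mem j.2) (h ▸ List.getElem_mem j'.2)
    rw [Fin.ext ((hL.nodup i).getElem_inj_iff.1 h)]
  · intro a
    obtain ⟨i, hi, -⟩ := hL.existsUnique_mem a
    obtain ⟨j, hj, rfl⟩ := List.getElem_of_mem hi
    exact ⟨⟨i, j, hj⟩, rfl⟩

/-- The permutation of the letters that runs cyclically through each word. -/
noncomputable def rotate (hL : IsPartition L) : Equiv.Perm α :=
  (Equiv.ofBijective _ hL.bijective_getElem).permCongr
    (Equiv.sigmaCongrRight fun _ => finRotate _)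

theorem rotate_getElem (hL : IsPartition L) (i : ι) {j : ℕ} (hj : j < (L i).length) :
    hL.rotate (L i)[j] = (L i)[(j + 1) % (L i).length]'(Nat.mod_lt _ (by omega)) := by
  have hletter : (L i)[j] = Equiv.ofBijective _ hL.bijective_getElem ⟨i, j, hj⟩ := rfl
  rw [hletter, rotate, Equiv.permCongr_apply, Equiv.symm_apply_apply]
  have : NeZero (L i).length := ⟨by omega⟩
  simp [finRotate_apply, Fin.val_add]

/-- The first letters of the words. -/
def head (hL : IsPartition L) : ι ↪ α where
  toFun i := (L i).head (hL.ne_nil i)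
  inj' i j h := hL.eq_of_mem (List.head_mem (hL.ne_nil i))
    (by simpa only [h] using List.head_mem (hL.ne_nil j))

/-- The permutation of the letters that runs through each word and then passes to the word that
follows it under a permutation of the words. -/
noncomputable def splice (hL : IsPartition L) (ctx : Equiv.Perm ι) : Equiv.Perm α :=
  hL.rotate.trans (ctx.viaEmbedding hL.head)

theorem splice_getElem (hL : IsPartition L) (ctx : Equiv.Perm ι) {i : ι} {j : ℕ}
    (hj : j + 1 < (L i).length) : hL.splice ctx (L i)[j] = (L i)[j + 1] := by
  rw [splice, Equiv.trans_apply, hL.rotate_getElem i (by omega)]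
  simp only [Nat.mod_eq_of_lt hj]
  apply Equiv.Perm.viaEmbedding_apply_of_notMem
  rintro ⟨k, hk : (L k).head _ = _⟩
  obtain rfl : k = i := hL.eq_of_mem (List.head_mem (hL.ne_nil k)) (hk ▸ List.getElem_mem hj)
  rw [List.head_eq_getElem] at hk
  exact absurd ((hL.nodup k).getElem_inj_iff.1 hk) (by omega)

theorem splice_getLast (hL : IsPartition L) (ctx : Equiv.Perm ι) (i : ι) :
    hL.splice ctx ((L i).getLast (hL.ne_nil i)) = (L (ctx i)).head (hL.ne_nil _) := by
  have hpos := List.length_pos_iff.2 (hL.ne_nil i)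
  have hrotate : hL.rotate ((L i).getLast (hL.ne_nil i)) = hL.head i := by
    rw [List.getLast_eq_getElem, hL.rotate_getElem i (by omega)]
    simp [head, List.head_eq_getElem, Nat.sub_add_cancel hpos]
  rw [splice, Equiv.trans_apply, hrotate, Equiv.Perm.viaEmbedding_apply]
  rfl

theorem isChain_splice (hL : IsPartition L) (ctx : Equiv.Perm ι) (i : ι) :
    (L i ++ L (ctx i)).IsChain (hL.splice ctx · = ·) := by
  have hword : ∀ k, (L k).IsChain (hL.splice ctx · = ·) := fun k =>
    List.isChain_iff_getElem.2 fun _ hj => hL.splice_getElem ctx hj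
  refine (hword i).append (hword _) fun a ha b hb => ?_
  obtain ⟨_, rfl⟩ := List.mem_getLast?_eq_getLast ha
  obtain ⟨_, rfl⟩ : ∃ h, b = (L (ctx i)).head h :=
    ⟨hL.ne_nil _, by simpa [List.head?_eq_some_head (hL.ne_nil _), eq_comm] using hb⟩
  exact hL.splice_getLast ctx i

theorem sumElim {X Y : Type*} {L : ι → List Y} (hL : IsPartition L) (E : X ⊕ Y ≃ α) :
    IsPartition (Sum.elim (fun x => [E (.inl x)]) fun i => (L i).map fun y => E (.inr y)) := by
  refine ⟨?_, ?_, fun a => ?_⟩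
  · rintro (x | i) <;> simp [hL.ne_nil]
  · rintro (x | i)
    · simp
    · exact (hL.nodup i).map (E.injective.comp Sum.inr_injective)
  · obtain ⟨x | y, rfl⟩ := E.surjective a
    · refine ⟨.inl x, by simp, ?_⟩
      rintro (x' | i) h
      · simpa [eq_comm] using h
      · simp at h
    · obtain ⟨i, hi, huniq⟩ := hL.existsUnique_mem y
      refine ⟨.inr i, by simpa using hi, ?_⟩
      rintro (x | j) h
      · simp at h
      · simpa using huniq j (by simpa using h)

end IsPartition

section Chain

variable {α : Type*} {q : α → α}

theorem infix_append_of_mem {l r : List α} (h : (l ++ r).IsChain (q · = ·)) (hr : r ≠ []) {a : α}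
    (ha : a ∈ l) : [a, q a] <:+: l ++ r := by
  obtain ⟨l₁, l₂, rfl⟩ := List.append_of_mem ha
  obtain ⟨b, m, hm⟩ := List.exists_cons_of_ne_nil (List.append_ne_nil_of_right_ne_nil l₂ hr)
  rw [List.append_assoc, List.cons_append, hm] at h ⊢
  have hpair : [a, b] <:+: l₁ ++ a :: b :: m := ⟨l₁, m, by simp⟩
  obtain rfl : q a = b := (List.isChain_pair (R := (q · = ·))).1 (h.infix hpair)
  exact hpair

theorem IsPartition.exists_infix {ι : Type*} {L : ι → List α} (hL : IsPartition L) {ctx : ι → ι}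
    (h : ∀ i, (L i ++ L (ctx i)).IsChain (q · = ·)) (a : α) :
    ∃ i, [a, q a] <:+: L i ++ L (ctx i) :=
  (hL.existsUnique_mem a).exists.imp fun i hi => infix_append_of_mem (h i) (hL.ne_nil _) hi

end Chain

instance : DecidableEq Level
  | .upper, .upper | .lower, .lower => isTrue rfl
  | .upper, .lower | .lower, .upper => isFalse nofun

instance : Fintype Level := ⟨{.upper, .lower}, by rintro (_ | _) <;> simp⟩

/-! ### Realizations of pictures -/

/-- The passages that stand for an exterior passage or for a strand of the picture `D`, the
crossings of the exterior and of `D` being named in `V` according to `f`. -/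
def Picture.passages {W V : Type} {n c : ℕ} (D : Picture n c) (f : W ⊕ Fin c → V) :
    (W × Level) ⊕ Fin n → List (V × Level) :=
  Sum.elim (fun p => [(f (.inl p.1), p.2)]) fun k => (D.strand k).map fun p => (f (.inr p.1), p.2)

theorem Picture.isPartition_passages {W V : Type} {n c : ℕ} {D : Picture n c}
    (hD : IsPartition D.strand) (f : W ⊕ Fin c ≃ V) : IsPartition (D.passages f) :=
  hD.sumElim ((Equiv.sumProdDistrib W (Fin c) Level).symm.trans (f.prodCongr (Equiv.refl _)))

namespace NormalOGraph

variable {Γ : NormalOGraph} {W : Type} {n c : ℕ} {D : Picture n c} {σ : W → ℤˣ}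
  {ctx : Equiv.Perm ((W × Level) ⊕ Fin n)}

theorem realizes_iff : Γ.Realizes D σ ctx ↔ ∃ f : W ⊕ Fin c ≃ Γ.V,
    (∀ w, Γ.sign (f (.inl w)) = σ w) ∧ (∀ i, Γ.sign (f (.inr i)) = D.sign i) ∧
      ∀ x, Γ.Consecutive (D.passages f x ++ D.passages f (ctx x)) :=
  Iff.rfl

theorem Consecutive.infix {l m : List (Γ.V × Level)} (h : Γ.Consecutive m) (hl : l <:+: m) :
    Γ.Consecutive l :=
  List.IsChain.infix h hl

theorem Realizes.finite (h : Γ.Realizes D σ ctx) : Finite W :=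
  have ⟨f, _⟩ := h
  have := Γ.finite_V
  .of_injective _ (f.injective.comp Sum.inl_injective)

end NormalOGraph

theorem Picture.exists_realizes {n c : ℕ} {D : Picture n c} (hD : IsPartition D.strand) {W : Type}
    [Finite W] (σ : W → ℤˣ) (ctx : Equiv.Perm ((W × Level) ⊕ Fin n)) :
    ∃ Γ : NormalOGraph, Γ.Realizes D σ ctx :=
  let hL := Picture.isPartition_passages hD (Equiv.refl (W ⊕ Fin c))
  ⟨⟨W ⊕ Fin c, inferInstance, Sum.elim σ D.sign, hL.splice ctx⟩, Equiv.refl _, fun _ => rfl,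
    fun _ => rfl, hL.isChain_splice ctx⟩

/-! ### Templates -/

/-- A picture with `s` gaps in its strands: in the words of the strands, the letter `.inr j` stands
for the gap into which the strand `j` of another picture can be inserted. -/
structure Template (n m s : ℕ) where
  sign : Fin m → ℤˣ
  strand : Fin n → List ((Fin m × Level) ⊕ Fin s)

namespace Template

variable {W : Type} {n m s c d : ℕ}

/-- The picture `D` is the template `T` with the picture `B` inserted into its gaps, the crossings
of `T` and of `B` being named in `D` according to `e`. -/
structure IsFill (T : Template n m s) (B : Picture s c) (D : Picture n d)
    (e : Fin m ⊕ Fin c → Fin d) : Prop where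
  bijective : Function.Bijective e
  sign_inl : ∀ i, D.sign (e (.inl i)) = T.sign i
  sign_inr : ∀ i, D.sign (e (.inr i)) = B.sign i
  strand : ∀ k, D.strand k = (T.strand k).flatMap (B.passages e)

instance (T : Template n m s) (B : Picture s c) (D : Picture n d) (e : Fin m ⊕ Fin c → Fin d) :
    Decidable (T.IsFill B D e) :=
  decidable_of_iff (Function.Bijective e ∧ (∀ i, D.sign (e (.inl i)) = T.sign i) ∧
      (∀ i, D.sign (e (.inr i)) = B.sign i) ∧
      ∀ k, D.strand k = (T.strand k).flatMap (B.passages e))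
    ⟨fun ⟨h₁, h₂, h₃, h₄⟩ => ⟨h₁, h₂, h₃, h₄⟩, fun ⟨h₁, h₂, h₃, h₄⟩ => ⟨h₁, h₂, h₃, h₄⟩⟩

/-- The words of exterior passages, crossings of `T` and gaps of `T` that stand for an exterior
passage or for a strand of `T`, when `T` is placed in an exterior with crossings `W`. -/
def blocks (T : Template n m s) (W : Type) :
    (W × Level) ⊕ Fin n → List (((W ⊕ Fin m) × Level) ⊕ Fin s) :=
  Sum.elim (fun p => [.inl (.inl p.1, p.2)])
    fun k => (T.strand k).map (Sum.map (fun p => (.inr p.1, p.2)) id)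

theorem isPartition_blocks {T : Template n m s} (hT : IsPartition T.strand) :
    IsPartition (T.blocks W) := by
  convert hT.sumElim ((Equiv.sumAssoc _ _ _).symm.trans
    ((Equiv.sumProdDistrib W (Fin m) Level).symm.sumCongr (Equiv.refl _))) using 1
  exact congrArg _ (funext fun k => congrArg (List.map · _) (funext fun p => by cases p <;> rfl))

variable {T : Template n m s} {B : Picture s c} {D : Picture n d} {e : Fin m ⊕ Fin c → Fin d}

/-- The crossings of an exterior, of a template and of its filling, named in the whole diagram. -/
noncomputable def IsFill.crossings {V : Type} (hD : T.IsFill B D e) (f : W ⊕ Fin d ≃ V) :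
    (W ⊕ Fin m) ⊕ Fin c ≃ V :=
  (Equiv.sumAssoc _ _ _).trans (((Equiv.refl W).sumCongr (.ofBijective e hD.bijective)).trans f)

theorem IsFill.passages_eq {V : Type} (hD : T.IsFill B D e) (f : W ⊕ Fin d ≃ V)
    (x : (W × Level) ⊕ Fin n) :
    D.passages f x = (T.blocks W x).flatMap (B.passages (hD.crossings f)) := by
  rcases x with x | k
  · rfl
  · simp only [Picture.passages, blocks, Sum.elim_inr, hD.strand, List.map_flatMap,
      List.flatMap_map]
    congr 1
    funext p
    rcases p with p | j
    · rfl
    · simp [IsFill.crossings, Function.comp_def]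

end Template

theorem NormalOGraph.Realizes.of_isFill {Γ : NormalOGraph} {W : Type} {n m s c d : ℕ}
    {T : Template n m s} {B : Picture s c} {D : Picture n d} {e : Fin m ⊕ Fin c → Fin d}
    (hT : IsPartition T.strand) (hD : T.IsFill B D e) {σ : W → ℤˣ}
    {ctx : Equiv.Perm ((W × Level) ⊕ Fin n)} (h : Γ.Realizes D σ ctx) :
    Γ.Realizes B (Sum.elim σ T.sign) ((Template.isPartition_blocks hT).splice ctx) := by
  obtain ⟨f, hexterior, hpicture, hnext⟩ := realizes_iff.1 h
  have hL := Template.isPartition_blocks (W := W) hT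
  refine realizes_iff.2 ⟨hD.crossings f, ?_, fun i => ?_, fun y => ?_⟩
  · rintro (w | i)
    · exact hexterior w
    · exact (hpicture _).trans (hD.sign_inl i)
  · exact (hpicture _).trans (hD.sign_inr i)
  · obtain ⟨x, hx⟩ := hL.exists_infix (hL.isChain_splice ctx) y
    have := hx.flatMap (B.passages (hD.crossings f))
    rw [List.flatMap_append, ← hD.passages_eq, ← hD.passages_eq] at this
    exact (hnext x).infix (by simpa using this)

/-! ### Half edges and corners of circuits -/

/-- A half edge of a diagram with crossings `V`: the passage at which it ends, together with `true`
if it leaves this passage and `false` if it arrives there. -/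
abbrev HalfEdge (V : Type) : Type := (V × Level) × Bool

namespace HalfEdge

variable {V V' : Type}

/-- The half edge along which the passage `p` is reached. -/
abbrev arriving (p : V × Level) : HalfEdge V := (p, false)

/-- The half edge along which the passage `p` is left. -/
abbrev leaving (p : V × Level) : HalfEdge V := (p, true)

/-- The half edge that corresponds to a half edge under a renaming of the crossings. -/
def map (f : V → V') : HalfEdge V → HalfEdge V' := Prod.map (Prod.map f id) id

/-- The pairs of lines that are joined at the crossing `v` of a diagram whose crossings have the
signs `ε`, in the order of the constructors of `NormalOGraph.Joined`. -/
def corners (ε : V → ℤˣ) (v : V) : List (Sym2 (HalfEdge V × Fin 3)) :=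
  let underLeft : HalfEdge V := ((v, .lower), ε v = 1)
  let underRight : HalfEdge V := ((v, .lower), ε v ≠ 1)
  let overLeft : HalfEdge V := ((v, .upper), ε v ≠ 1)
  let overRight : HalfEdge V := ((v, .upper), ε v = 1)
  [s((underLeft, 0), (underRight, 0)), s((underLeft, 2), (overRight, 0)),
    s((underRight, 2), (overRight, 2)), s((underLeft, 1), (overLeft, 0)),
    s((underRight, 1), (overLeft, 2)), s((overRight, 1), (overLeft, 1))]

theorem map_mem_corners {f : V → V'} {ε : V → ℤˣ} {ε' : V' → ℤˣ} {v : V} (hε : ε' (f v) = ε v)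
    {x y : HalfEdge V × Fin 3} (h : s(x, y) ∈ corners ε v) :
    s((x.1.map f, x.2), (y.1.map f, y.2)) ∈ corners ε' (f v) := by
  have hmap : corners ε' (f v) = (corners ε v).map (Sym2.map fun z => (z.1.map f, z.2)) := by
    simp only [corners, hε]
    rfl
  rw [hmap]
  exact List.mem_map_of_mem h

end HalfEdge

open HalfEdge

namespace NormalOGraph

variable {Γ : NormalOGraph}

/-- The edge that contains a half edge. -/
def edge (Γ : NormalOGraph) (h : HalfEdge Γ.V) : Γ.Edge :=
  if h.2 then h.1 else Γ.next.symm h.1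

theorem edge_arriving_next (e : Γ.Edge) : Γ.edge (arriving (Γ.next e)) = e :=
  Γ.next.symm_apply_apply e

theorem sameCircuit_of_mem_corners {v : Γ.V} {x y : HalfEdge Γ.V × Fin 3}
    (h : s(x, y) ∈ corners Γ.sign v) : Γ.SameCircuit (Γ.edge x.1, x.2) (Γ.edge y.1, y.2) := by
  obtain ⟨hUL, hUR, hOL, hOR⟩ :
      Γ.edge ((v, .lower), Γ.sign v = 1) = Γ.underLeft v ∧
      Γ.edge ((v, .lower), Γ.sign v ≠ 1) = Γ.underRight v ∧
      Γ.edge ((v, .upper), Γ.sign v ≠ 1) = Γ.overLeft v ∧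
      Γ.edge ((v, .upper), Γ.sign v = 1) = Γ.overRight v := by
    by_cases hv : Γ.sign v = 1 <;>
      simp [hv, edge, underLeft, underRight, overLeft, overRight, inEdge, outEdge]
  have joined : ∀ {z : Sym2 Γ.Line}, z ∈ (corners Γ.sign v).map
      (Sym2.map fun z => (Γ.edge z.1, z.2)) → ∃ x y, Γ.Joined x y ∧ z = s(x, y) := by
    simp only [corners, List.map_cons, List.map_nil, Sym2.map_mk, hUL, hUR, hOL, hOR,
      List.forall_mem_cons]
    refine ⟨⟨_, _, .c01 v, rfl⟩, ⟨_, _, .c02 v, rfl⟩, ⟨_, _, .c03 v, rfl⟩, ⟨_, _, .c12 v, rfl⟩,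
      ⟨_, _, .c13 v, rfl⟩, ⟨_, _, .c23 v, rfl⟩, by simp⟩
  obtain ⟨x', y', hjoined, heq⟩ := joined (List.mem_map_of_mem h)
  obtain ⟨hx, hy⟩ | ⟨hx, hy⟩ := Sym2.eq_iff.1 heq <;> simp only at hx hy <;> rw [hx, hy]
  exacts [.rel _ _ hjoined, .symm _ _ (.rel _ _ hjoined)]

end NormalOGraph

namespace Picture

variable {n c : ℕ}

/-- Two lines of half edges of `D` are joined at a crossing of `D`. -/
def Joins (D : Picture n c) (x y : HalfEdge (Fin c) × Fin 3) : Prop :=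
  ∃ i, s(x, y) ∈ corners D.sign i

instance (D : Picture n c) (x y : HalfEdge (Fin c) × Fin 3) : Decidable (D.Joins x y) :=
  inferInstanceAs (Decidable (∃ _, _))

/-- The lines `x` and `y` are joined, at the two ends of an edge within `D`, to the same line of
this edge. -/
def JoinsViaInnerEdge (D : Picture n c) (x y : HalfEdge (Fin c) × Fin 3) : Prop :=
  ∃ p q, (∃ k, [p, q] <:+: D.strand k) ∧ ∃ i,
    D.Joins x (leaving p, i) ∧ D.Joins (arriving q, i) y ∨
      D.Joins x (arriving q, i) ∧ D.Joins (leaving p, i) y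

instance (D : Picture n c) (x y : HalfEdge (Fin c) × Fin 3) : Decidable (D.JoinsViaInnerEdge x y) :=
  inferInstanceAs (Decidable (∃ _, _))

end Picture

/-! ### Pure sliding moves within a picture -/

namespace HalfEdge

variable {V α : Type} [DecidableEq V]

/-- What is met along the half edge `h` when the words `l` and `r` have been inserted into the half
edges `a` and `b`, in this order if `a = b`. -/
def inserted (a b : HalfEdge V) (l r : List α) (h : HalfEdge V) : List α :=
  (if h = a then l else []) ++ if h = b then r else []

/-- The word met around the passage `p`, which is renamed to `old p`, when the words `l` and `r`
have been inserted into the half edges `a` and `b`. -/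
def wordAround (a b : HalfEdge V) (l r : List α) (old : V × Level → α) (p : V × Level) : List α :=
  inserted a b l r (arriving p) ++ [old p] ++ inserted a b l r (leaving p)

end HalfEdge

/-- The picture that results from `D` by the pure sliding move `t` with the left arc on the half
edge `a` and the right arc on the half edge `b`. The two new crossings come last. -/
def Picture.slide {n c : ℕ} (D : Picture n c) (t : PSType) (a b : HalfEdge (Fin c)) :
    Picture n (c + 2) where
  sign := Fin.append D.sign t.picture.sign
  strand k := (D.strand k).flatMap <| wordAround a b
    ((t.picture.strand 0).map fun p => (Fin.natAdd c p.1, p.2))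
    ((t.picture.strand 1).map fun p => (Fin.natAdd c p.1, p.2)) fun p => (Fin.castAdd 2 p.1, p.2)

namespace HalfEdge

variable {V V' α β : Type}

theorem inserted_map [DecidableEq V] [DecidableEq V'] {f : V → V'} (hf : f.Injective)
    (a b : HalfEdge V) (l r : List α) (h : HalfEdge V) :
    inserted (a.map f) (b.map f) l r (h.map f) = inserted a b l r h := by
  have hmap : (HalfEdge.map f).Injective :=
    (hf.prodMap Function.injective_id).prodMap Function.injective_id
  simp only [inserted, hmap.eq_iff]

theorem inserted_of_notMem_range [DecidableEq V'] {f : V → V'} (a b : HalfEdge V) (l r : List α)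
    {h : HalfEdge V'} (hh : h.1.1 ∉ Set.range f) :
    inserted (a.map f) (b.map f) l r h = [] := by
  have hne : ∀ x : HalfEdge V, h ≠ x.map f := by
    rintro x rfl
    exact hh ⟨x.1.1, rfl⟩
  simp [inserted, hne]

theorem map_inserted [DecidableEq V] (g : α → β) (a b : HalfEdge V) (l r : List α)
    (h : HalfEdge V) :
    (inserted a b l r h).map g = inserted a b (l.map g) (r.map g) h := by
  simp only [inserted, List.map_append, apply_ite (List.map g), List.map_nil]

theorem infix_wordAround_append [DecidableEq V] (a b : HalfEdge V) (l r : List α)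
    (old : V × Level → α) (p q : V × Level) :
    [old p] ++ (inserted a b l r (leaving p) ++ inserted a b l r (arriving q)) ++ [old q] <:+:
      wordAround a b l r old p ++ wordAround a b l r old q :=
  ⟨inserted a b l r (arriving p), inserted a b l r (leaving q), by
    simp only [wordAround, List.append_assoc]⟩

end HalfEdge

open scoped Classical in
/-- Both half edges may lie on the edge `e`; then the word at `b` comes first exactly if `b` is its
first half and `a` its second half. -/
theorem NormalOGraph.inserted_leaving_append_inserted_arriving {Γ : NormalOGraph} {α : Type}
    (a b : HalfEdge Γ.V) (l r : List α) (e : Γ.Edge) :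
    inserted a b l r (leaving e) ++ inserted a b l r (arriving (Γ.next e)) =
      if a.2 = false ∧ b.2 = true
      then (if e = Γ.edge b then r else []) ++ if e = Γ.edge a then l else []
      else (if e = Γ.edge a then l else []) ++ if e = Γ.edge b then r else [] := by
  obtain ⟨p, _ | _⟩ := a <;> obtain ⟨q, _ | _⟩ := b <;>
    simp [inserted, edge, Equiv.eq_symm_apply]

open scoped Classical in
theorem PSType.rel_of_consecutive_wordAround {Γ Γ' : NormalOGraph} {t : PSType}
    {a b : HalfEdge Γ.V} (hcircuit : Γ.SameCircuit (Γ.edge a, t.lines.1) (Γ.edge b, t.lines.2))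
    (f : Γ.V ⊕ Fin 2 ≃ Γ'.V) (hold : ∀ v, Γ'.sign (f (.inl v)) = Γ.sign v)
    (hnew : ∀ i, Γ'.sign (f (.inr i)) = t.picture.sign i)
    {word : Γ.V × Level → List (Γ'.V × Level)}
    (hword : word = wordAround a b ((t.picture.strand 0).map fun p => (f (.inr p.1), p.2))
      ((t.picture.strand 1).map fun p => (f (.inr p.1), p.2)) fun p => (f (.inl p.1), p.2))
    (hnext : ∀ e, Γ'.Consecutive (word e ++ word (Γ.next e))) : t.Rel Γ Γ' := by
  refine ⟨Γ.edge a, Γ.edge b, hcircuit, f, hold, hnew, ?_⟩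
  have hedge := fun e => (hnext e).infix (hword ▸ infix_wordAround_append ..)
  simp only [Γ.inserted_leaving_append_inserted_arriving] at hedge
  by_cases hab : a.2 = false ∧ b.2 = true
  · exact .inr fun e => by simpa only [if_pos hab, List.append_assoc] using hedge e
  · exact .inl fun e => by simpa only [if_neg hab, List.append_assoc] using hedge e

namespace Picture

variable {W V V' : Type} {n c : ℕ} {D : Picture n c} {t : PSType} {a b : HalfEdge (Fin c)}

/-- The crossings of a diagram and the two new crossings, named in the diagram after a slide. -/
def slideCrossings (f : W ⊕ Fin c ≃ V) (g : W ⊕ Fin (c + 2) ≃ V') : V ⊕ Fin 2 ≃ V' :=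
  (f.symm.sumCongr (Equiv.refl _)).trans <| (Equiv.sumAssoc _ _ _).trans <|
    ((Equiv.refl W).sumCongr finSumFinEquiv).trans g

open scoped Classical in
theorem passages_slide (f : W ⊕ Fin c ≃ V) (g : W ⊕ Fin (c + 2) ≃ V')
    (x : (W × Level) ⊕ Fin n) :
    (D.slide t a b).passages g x = (D.passages f x).flatMap
      (wordAround (a.map (f ∘ .inr)) (b.map (f ∘ .inr))
        ((t.picture.strand 0).map fun p => (slideCrossings f g (.inr p.1), p.2))
        ((t.picture.strand 1).map fun p => (slideCrossings f g (.inr p.1), p.2))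
        fun p => (slideCrossings f g (.inl p.1), p.2)) := by
  have hold : ∀ w, slideCrossings f g (.inl (f (.inl w))) = g (.inl w) := by simp [slideCrossings]
  have hpicture : ∀ i, slideCrossings f g (.inl (f (.inr i))) = g (.inr (Fin.castAdd 2 i)) := by
    simp [slideCrossings]
  have hnew : ∀ i, slideCrossings f g (.inr i) = g (.inr (Fin.natAdd c i)) := by
    simp [slideCrossings]
  have hinj : (f ∘ .inr).Injective := f.injective.comp Sum.inr_injective
  rcases x with ⟨w, s⟩ | k
  · have hw : f (.inl w) ∉ Set.range (f ∘ .inr) := by simp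
    simp [passages, wordAround, inserted_of_notMem_range, hw, hold]
  · have hletter : ∀ (p : Fin c × Level) (s : Bool),
        ((f (.inr p.1), p.2), s) = HalfEdge.map (f ∘ .inr) (p, s) := fun _ _ => rfl
    simp only [passages, slide, Sum.elim_inr, List.map_flatMap, List.flatMap_map]
    congr 1
    funext p
    simp only [wordAround, arriving, leaving, hletter, inserted_map hinj, List.map_append,
      map_inserted, List.map_map, List.map_cons, List.map_nil, hpicture, hnew]
    rfl

theorem JoinsViaInnerEdge.sameCircuit {Γ : NormalOGraph} {f : W ⊕ Fin c → Γ.V}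
    {x y : HalfEdge (Fin c) × Fin 3} (h : D.JoinsViaInnerEdge x y)
    (hsign : ∀ i, Γ.sign (f (.inr i)) = D.sign i)
    (hnext : ∀ k, Γ.Consecutive ((D.strand k).map fun p => (f (.inr p.1), p.2))) :
    Γ.SameCircuit (Γ.edge (x.1.map (f ∘ .inr)), x.2) (Γ.edge (y.1.map (f ∘ .inr)), y.2) := by
  have hjoins : ∀ {x y}, D.Joins x y →
      Γ.SameCircuit (Γ.edge (x.1.map (f ∘ .inr)), x.2) (Γ.edge (y.1.map (f ∘ .inr)), y.2) :=
    fun ⟨i, hi⟩ => NormalOGraph.sameCircuit_of_mem_corners (map_mem_corners (hsign i) hi)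
  obtain ⟨p, q, ⟨k, hpq⟩, i, h⟩ := h
  have hinner : Γ.edge ((leaving p).map (f ∘ .inr)) = Γ.edge ((arriving q).map (f ∘ .inr)) := by
    have hpair : Γ.next (f (.inr p.1), p.2) = (f (.inr q.1), q.2) :=
      (List.isChain_pair (R := (Γ.next · = ·))).1 <|
        (hnext k).infix (hpq.map fun p : Fin c × Level => (f (.inr p.1), p.2))
    exact (Γ.edge_arriving_next _).symm.trans (congrArg (fun q => Γ.edge (arriving q)) hpair)
  obtain ⟨hx, hy⟩ | ⟨hx, hy⟩ := h
  · exact .trans _ _ _ (hjoins hx) (hinner ▸ hjoins hy)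
  · exact .trans _ _ _ (hjoins hx) (hinner ▸ hjoins hy)

end Picture

theorem PSType.rel_of_realizes_slide {n c : ℕ} {D : Picture n c} (hD : IsPartition D.strand)
    {t : PSType} {a b : HalfEdge (Fin c)} (hab : D.JoinsViaInnerEdge (a, t.lines.1) (b, t.lines.2))
    {W : Type} {σ : W → ℤˣ} {ctx : Equiv.Perm ((W × Level) ⊕ Fin n)} {Γ Γ' : NormalOGraph}
    (h : Γ.Realizes D σ ctx) (h' : Γ'.Realizes (D.slide t a b) σ ctx) : t.Rel Γ Γ' := by
  classical
  obtain ⟨f, hexterior, hpicture, hnext⟩ := NormalOGraph.realizes_iff.1 h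
  obtain ⟨g, hexterior', hpicture', hnext'⟩ := NormalOGraph.realizes_iff.1 h'
  refine rel_of_consecutive_wordAround (hab.sameCircuit hpicture fun k => ?_)
    (Picture.slideCrossings f g) (fun v => ?_) (fun i => ?_) rfl fun e => ?_
  · exact (hnext (.inr k)).infix (List.prefix_append _ _).isInfix
  · obtain ⟨w | i, rfl⟩ := f.surjective v
    · simp [Picture.slideCrossings, hexterior, hexterior']
    · simp [Picture.slideCrossings, hpicture, hpicture', Picture.slide]
  · simp [Picture.slideCrossings, hpicture', Picture.slide]
  · obtain ⟨x, hx⟩ := (Picture.isPartition_passages hD f).exists_infix hnext e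
    refine (hnext' x).infix ?_
    rw [Picture.passages_slide f g, Picture.passages_slide f g, ← List.flatMap_append]
    simpa only [List.flatMap_cons, List.flatMap_nil, List.append_nil] using hx.flatMap _

/-! ### Connectedness -/

namespace NormalOGraph

variable {Γ : NormalOGraph}

/-- The truth value `φ` of a crossing does not change along the edges of `Γ`, i.e. `φ` describes a
union of connected components. -/
def IsInvariant (Γ : NormalOGraph) (φ : Γ.V → Prop) : Prop :=
  ∀ p, φ (Γ.next p).1 = φ p.1

theorem isConnected_iff :
    Γ.IsConnected ↔ Nonempty Γ.V ∧ ∀ φ, Γ.IsInvariant φ → ∀ v w, φ v = φ w := by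
  refine and_congr_right fun _ => ⟨fun h φ hφ v w => ?_, fun h v w => ?_⟩
  · induction h v w with
    | rel v w hvw =>
      obtain ⟨s, t, hst⟩ := hvw
      simpa only [hst] using (hφ (v, s)).symm
    | refl => rfl
    | symm _ _ _ ih => exact ih.symm
    | trans _ _ _ _ _ ih₁ ih₂ => exact ih₁.trans ih₂
  · refine (h (Relation.EqvGen _ v) (fun p => propext ?_) v w).mp (.refl v)
    have hp := Relation.EqvGen.rel (r := fun a b => ∃ s t : Level, Γ.next (a, s) = (b, t)) _ _
      ⟨p.2, (Γ.next p).2, rfl⟩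
    exact ⟨fun h => h.trans _ _ _ hp.symm, fun h => h.trans _ _ _ hp⟩

namespace IsInvariant

variable {φ : Γ.V → Prop}

theorem eq_of_consecutive (hφ : Γ.IsInvariant φ) {l : List (Γ.V × Level)} (hl : Γ.Consecutive l)
    {p q : Γ.V × Level} (hp : p ∈ l) (hq : q ∈ l) : φ p.1 = φ q.1 := by
  let R : Γ.V × Level → Γ.V × Level → Prop := fun p q => φ p.1 = φ q.1
  have : IsTrans _ R := ⟨fun _ _ _ => .trans⟩
  have : Std.Symm R := ⟨fun _ _ => .symm⟩
  have hpairwise : l.Pairwise R :=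
    (hl.imp fun p q (hpq : Γ.next p = q) => hpq ▸ (hφ p).symm).pairwise
  exact List.Pairwise.forall_of_forall (R := R) (fun _ _ => rfl) hpairwise hp hq

theorem eq_of_sameCircuit (hφ : Γ.IsInvariant φ) {x y : Γ.Line} (h : Γ.SameCircuit x y) :
    φ x.1.1 = φ y.1.1 := by
  have hin : ∀ v s, φ (Γ.inEdge v s).1 = φ v := fun v s => by
    simpa [inEdge] using (hφ (Γ.inEdge v s)).symm
  have hout : ∀ v s, φ (Γ.outEdge v s).1 = φ v := fun _ _ => rfl
  induction h with
  | rel x y h =>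
    cases h <;>
      simp only [underLeft, underRight, overLeft, overRight, apply_ite Prod.fst, apply_ite φ, hin,
        hout, ite_self]
  | refl => rfl
  | symm _ _ _ ih => exact ih.symm
  | trans _ _ _ _ _ ih₁ ih₂ => exact ih₁.trans ih₂

end IsInvariant

end NormalOGraph

section Exterior

variable {W V : Type} {n c : ℕ}

/-- The place of an exterior passage or of a strand of a picture after collapsing the picture to a
point: a crossing of the exterior, or `none` for the collapsed picture. -/
def place : (W × Level) ⊕ Fin n → Option W :=
  Sum.elim (fun p => some p.1) fun _ => none

/-- An exterior is connected once the picture has been collapsed to a point. -/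
def IsConnectedExterior (ctx : Equiv.Perm ((W × Level) ⊕ Fin n)) : Prop :=
  ∀ χ : Option W → Prop, (∀ x, χ (place (ctx x)) = χ (place x)) → ∀ u v, χ u = χ v

/-- The place of a crossing of a diagram after collapsing a picture to a point. -/
def collapse (f : W ⊕ Fin c ≃ V) (v : V) : Option W :=
  Sum.elim some (fun _ => none) (f.symm v)

theorem collapse_of_mem_passages {D : Picture n c} {f : W ⊕ Fin c ≃ V} {x : (W × Level) ⊕ Fin n}
    {p : V × Level} (hp : p ∈ D.passages f x) : collapse f p.1 = place x := by
  rcases x with x | k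
  · obtain rfl := List.mem_singleton.1 hp
    simp [collapse, place]
  · obtain ⟨p, -, rfl⟩ := List.mem_map.1 hp
    simp [collapse, place]

end Exterior

namespace NormalOGraph

variable {Γ : NormalOGraph} {W : Type} {n c : ℕ} {D : Picture n c} {σ : W → ℤˣ}
  {ctx : Equiv.Perm ((W × Level) ⊕ Fin n)}

theorem IsConnected.isConnectedExterior (hD : IsPartition D.strand) (i₀ : Fin c)
    (h : Γ.Realizes D σ ctx) (hΓ : Γ.IsConnected) : IsConnectedExterior ctx := by
  obtain ⟨f, -, -, hnext⟩ := realizes_iff.1 h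
  intro χ hχ
  have hinvariant : Γ.IsInvariant (χ ∘ collapse f) := by
    intro p
    obtain ⟨x, hx⟩ := (Picture.isPartition_passages hD f).exists_infix hnext p
    have hcolor : ∀ q ∈ D.passages f x ++ D.passages f (ctx x),
        χ (collapse f q.1) = χ (place x) := by
      intro q hq
      obtain hq | hq := List.mem_append.1 hq
      · rw [collapse_of_mem_passages hq]
      · rw [collapse_of_mem_passages hq, hχ]
    exact (hcolor _ (hx.subset (by simp))).trans (hcolor p (hx.subset (by simp))).symm
  have hsurjective : (collapse f).Surjective := by
    rintro (_ | w)
    exacts [⟨f (.inr i₀), by simp [collapse]⟩, ⟨f (.inl w), by simp [collapse]⟩]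
  exact hsurjective.forall₂.2 ((isConnected_iff.1 hΓ).2 _ hinvariant)

theorem IsConnected.of_isConnectedExterior (hD : ∀ k, D.strand k ≠ []) (i₀ : Fin c)
    (hub : ∀ i, ∃ k s t, (i₀, s) ∈ D.strand k ∧ (i, t) ∈ D.strand k) (h : Γ.Realizes D σ ctx)
    (hctx : IsConnectedExterior ctx) : Γ.IsConnected := by
  obtain ⟨f, -, -, hnext⟩ := realizes_iff.1 h
  refine isConnected_iff.2 ⟨⟨f (.inr i₀)⟩, fun φ hφ => ?_⟩
  let χ : Option W → Prop := fun u => φ (u.elim (f (.inr i₀)) fun w => f (.inl w))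
  have hcollapse : ∀ v, φ v = χ (collapse f v) := by
    intro v
    obtain ⟨w | i, rfl⟩ := f.surjective v
    · simp [χ, collapse]
    · obtain ⟨k, s, t, hs, ht⟩ := hub i
      have hk : Γ.Consecutive (D.passages f (.inr k)) :=
        (hnext (.inr k)).infix (List.prefix_append _ _).isInfix
      simpa [χ, collapse] using
        hφ.eq_of_consecutive hk (List.mem_map_of_mem ht) (List.mem_map_of_mem hs)
  have hne : ∀ x, D.passages f x ≠ [] := by
    rintro (x | k) <;> simp [Picture.passages, hD]
  have hχ : ∀ x, χ (place (ctx x)) = χ (place x) := by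
    intro x
    obtain ⟨p, hp⟩ := List.exists_mem_of_ne_nil _ (hne x)
    obtain ⟨q, hq⟩ := List.exists_mem_of_ne_nil _ (hne (ctx x))
    rw [← collapse_of_mem_passages hp, ← collapse_of_mem_passages hq, ← hcollapse, ← hcollapse]
    exact hφ.eq_of_consecutive (hnext x) (List.mem_append_right _ hq) (List.mem_append_left _ hp)
  intro v w
  rw [hcollapse v, hcollapse w]
  exact hctx χ hχ _ _

/-- All crossings of the picture belong to one component because each of them shares a strand with
`i₀`, so collapsing the picture to a point does not affect connectedness. -/
theorem Realizes.isConnected_iff (hD : IsPartition D.strand) (i₀ : Fin c)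
    (hub : ∀ i, ∃ k s t, (i₀, s) ∈ D.strand k ∧ (i, t) ∈ D.strand k) (h : Γ.Realizes D σ ctx) :
    Γ.IsConnected ↔ IsConnectedExterior ctx :=
  ⟨IsConnected.isConnectedExterior hD i₀ h, .of_isConnectedExterior hD.ne_nil i₀ hub h⟩

end NormalOGraph

theorem primaryMP_isConnected_iff {Γ Γ' : NormalOGraph} (h : primaryMP.Rel Γ Γ') :
    Γ.IsConnected ↔ Γ'.IsConnected := by
  obtain ⟨W, σ, ctx, hbefore, hafter⟩ := h
  exact (hbefore.isConnected_iff (by decide) 0 (by decide)).trans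
    (hafter.isConnected_iff (by decide) 0 (by decide)).symm

section Subdivision

variable {Γ Γ' : NormalOGraph} {X : Type}

/-- The passages met along the edge `e`, starting with `e` itself, when the words `ins` of new
passages have been inserted into the edges; the crossings are named according to `f`. -/
def subdivided {V V' : Type} (f : V ⊕ X → V') (ins : V × Level → List (X × Level))
    (e : V × Level) : List (V' × Level) :=
  (f (.inl e.1), e.2) :: (ins e).map fun p => (f (.inr p.1), p.2)

theorem NormalOGraph.IsConnected.of_subdivided {f : Γ.V ⊕ X ≃ Γ'.V}
    {ins : Γ.Edge → List (X × Level)} (hcover : ∀ x, ∃ e s, (x, s) ∈ ins e)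
    (hnext : ∀ e, Γ'.Consecutive (subdivided f ins e ++ [(f (.inl (Γ.next e).1), (Γ.next e).2)]))
    (hΓ : Γ.IsConnected) : Γ'.IsConnected := by
  obtain ⟨⟨v₀⟩, hΓ⟩ := isConnected_iff.1 hΓ
  refine isConnected_iff.2 ⟨⟨f (.inl v₀)⟩, fun φ hφ => ?_⟩
  have hedge : ∀ e, ∀ p ∈ subdivided f ins e ++ [(f (.inl (Γ.next e).1), (Γ.next e).2)],
      φ p.1 = φ (f (.inl e.1)) := fun e p hp =>
    hφ.eq_of_consecutive (hnext e) hp (List.mem_append_left _ List.mem_cons_self)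
  have hold : ∀ v, φ (f (.inl v)) = φ (f (.inl v₀)) := fun v =>
    hΓ (fun v => φ (f (.inl v)))
      (fun e => hedge e _ (List.mem_append_right _ List.mem_cons_self)) v v₀
  suffices h : ∀ v, φ v = φ (f (.inl v₀)) from fun v w => (h v).trans (h w).symm
  intro v
  obtain ⟨v | x, rfl⟩ := f.surjective v
  · exact hold v
  · obtain ⟨e, s, he⟩ := hcover x
    exact (hedge e (f (.inr x), s) (by simp [subdivided, he])).trans (hold e.1)

theorem NormalOGraph.IsConnected.of_isConnected_subdivided {f : Γ.V ⊕ X ≃ Γ'.V}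
    {ins : Γ.Edge → List (X × Level)} (hcover : ∀ p, ∃ e, p ∈ ins e)
    (hlinked : ∀ φ, Γ.IsInvariant φ → ∃ χ : X → Prop, ∀ e, ∀ p ∈ ins e, χ p.1 = φ e.1)
    (hnext : ∀ e, Γ'.Consecutive (subdivided f ins e ++ [(f (.inl (Γ.next e).1), (Γ.next e).2)]))
    (hΓ' : Γ'.IsConnected) : Γ.IsConnected := by
  obtain ⟨⟨v₀⟩, hΓ'⟩ := isConnected_iff.1 hΓ'
  have hnonempty : Nonempty Γ.V := by
    obtain ⟨v | x, rfl⟩ := f.surjective v₀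
    exacts [⟨v⟩, (hcover (x, .upper)).elim fun e _ => ⟨e.1⟩]
  refine isConnected_iff.2 ⟨hnonempty, fun φ hφ v w => ?_⟩
  obtain ⟨χ, hχ⟩ := hlinked φ hφ
  have hedge : ∀ e, ∀ p ∈ subdivided f ins e ++ [(f (.inl (Γ.next e).1), (Γ.next e).2)],
      Sum.elim φ χ (f.symm p.1) = φ e.1 := by
    intro e p hp
    obtain (rfl | hp) | rfl : (p = (f (.inl e.1), e.2) ∨
        ∃ q ∈ ins e, (f (.inr q.1), q.2) = p) ∨ p = (f (.inl (Γ.next e).1), (Γ.next e).2) := by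
      simpa only [subdivided, List.mem_append, List.mem_cons, List.mem_map, List.not_mem_nil,
        or_false] using hp
    · simp
    · obtain ⟨q, hq, rfl⟩ := hp
      simpa using hχ e q hq
    · simpa using hφ e
  have hinvariant : Γ'.IsInvariant fun v => Sum.elim φ χ (f.symm v) := by
    intro p
    obtain ⟨e, he⟩ : ∃ e, p ∈ subdivided f ins e := by
      obtain ⟨v, s⟩ := p
      obtain ⟨v | x, rfl⟩ := f.surjective v
      · exact ⟨(v, s), List.mem_cons_self⟩
      · exact (hcover (x, s)).imp fun e he => by simp [subdivided, he]
    have hinfix := infix_append_of_mem (hnext e) (List.cons_ne_nil _ _) he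
    exact (hedge e _ (hinfix.subset (by simp))).trans (hedge e p (hinfix.subset (by simp))).symm
  simpa using hΓ' _ hinvariant (f (.inl v)) (f (.inl w))

end Subdivision

namespace PSType

theorem isPartition_strand (t : PSType) : IsPartition t.picture.strand := by
  cases t <;> decide

open scoped Classical in
theorem Rel.exists_subdivided {t : PSType} {Γ Γ' : NormalOGraph} (h : t.Rel Γ Γ') :
    ∃ a : Fin 2 → Γ.Edge, (∀ φ, Γ.IsInvariant φ → φ (a 0).1 = φ (a 1).1) ∧
      ∃ (f : Γ.V ⊕ Fin 2 ≃ Γ'.V) (ins : Γ.Edge → List (Fin 2 × Level)),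
        (∀ e p, p ∈ ins e ↔ ∃ k, e = a k ∧ p ∈ t.picture.strand k) ∧
        ∀ e, Γ'.Consecutive (subdivided f ins e ++ [(f (.inl (Γ.next e).1), (Γ.next e).2)]) := by
  obtain ⟨a, b, hab, f, -, -, hnext⟩ := h
  let left : Γ.Edge → List (Fin 2 × Level) := fun e => if e = a then t.picture.strand 0 else []
  let right : Γ.Edge → List (Fin 2 × Level) := fun e => if e = b then t.picture.strand 1 else []
  have hmem : ∀ e p, (p ∈ left e ∨ p ∈ right e) ↔ ∃ k, e = ![a, b] k ∧ p ∈ t.picture.strand k := by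
    intro e p
    rw [Fin.exists_fin_two]
    by_cases ha : e = a <;> by_cases hb : e = b <;> simp [left, right, ha, hb]
  refine ⟨![a, b], fun φ hφ => hφ.eq_of_sameCircuit hab, f, ?_⟩
  obtain hnext | hnext := hnext
  · refine ⟨fun e => left e ++ right e, fun e p => List.mem_append.trans (hmem e p), fun e => ?_⟩
    simpa [subdivided, left, right, apply_ite (List.map _)] using hnext e
  · refine ⟨fun e => right e ++ left e,
      fun e p => (List.mem_append.trans or_comm).trans (hmem e p), fun e => ?_⟩
    simpa [subdivided, left, right, apply_ite (List.map _)] using hnext e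

theorem isConnected_iff {t : PSType} {Γ Γ' : NormalOGraph} (h : t.Rel Γ Γ') :
    Γ.IsConnected ↔ Γ'.IsConnected := by
  obtain ⟨a, ha, f, ins, hins, hnext⟩ := h.exists_subdivided
  have hcover : ∀ p, ∃ e, p ∈ ins e := fun p =>
    have ⟨k, hk, _⟩ := t.isPartition_strand.existsUnique_mem p
    ⟨a k, (hins _ _).2 ⟨k, rfl, hk⟩⟩
  refine ⟨.of_subdivided (fun x => (hcover (x, .upper)).imp fun _ h => ⟨_, h⟩) hnext,
    .of_isConnected_subdivided hcover (fun φ hφ => ⟨fun _ => φ (a 0).1, fun e p hp => ?_⟩) hnext⟩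
  obtain ⟨k, rfl, -⟩ := (hins e p).1 hp
  fin_cases k
  exacts [rfl, ha φ hφ]

end PSType

theorem Step.isConnected_iff {s : Step} {Γ Γ' : NormalOGraph} (h : s.Rel Γ Γ') :
    Γ.IsConnected ↔ Γ'.IsConnected := by
  obtain (_ | t) | (_ | t) := s
  exacts [primaryMP_isConnected_iff h, PSType.isConnected_iff h, (primaryMP_isConnected_iff h).symm,
    (PSType.isConnected_iff h).symm]

/-! ### Words in the generating moves -/

/-- `Γ'` is obtained from `Γ` by the successive letters of the word `w`. -/
def MovePath : List Step → NormalOGraph → NormalOGraph → Prop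
  | [], Γ, Γ' => Γ = Γ'
  | s :: w, Γ, Γ' => ∃ Γ₁, s.Rel Γ Γ₁ ∧ MovePath w Γ₁ Γ'

/-- The inverse of a letter. -/
def Step.symm : Step → Step
  | forward g => inverse g
  | inverse g => forward g

theorem Step.Rel.symm {s : Step} {Γ Γ' : NormalOGraph} (h : s.Rel Γ Γ') : s.symm.Rel Γ' Γ := by
  cases s <;> exact h

/-- The inverse of a word, which undoes it. -/
def inverseWord (w : List Step) : List Step := (w.map Step.symm).reverse

namespace MovePath

variable {w w' : List Step} {Γ Γ₁ Γ' : NormalOGraph}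

theorem append (h : MovePath w Γ Γ₁) (h' : MovePath w' Γ₁ Γ') : MovePath (w ++ w') Γ Γ' := by
  induction w generalizing Γ with
  | nil => exact h ▸ h'
  | cons s w ih => exact h.imp fun Γ₂ ⟨hs, hw⟩ => ⟨hs, ih hw⟩

theorem symm (h : MovePath w Γ Γ') : MovePath (inverseWord w) Γ' Γ := by
  induction w generalizing Γ with
  | nil => exact Eq.symm h
  | cons s w ih =>
    obtain ⟨Γ₁, hs, hw⟩ := h
    rw [inverseWord, List.map_cons, List.reverse_cons]
    exact (ih hw).append ⟨Γ, hs.symm, rfl⟩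

theorem exists_sequence (h : MovePath w Γ Γ') :
    ∃ Δ : Fin (w.length + 1) → NormalOGraph,
      Δ 0 = Γ ∧ Δ (Fin.last w.length) = Γ' ∧
      (∀ i : Fin w.length, (w.get i).Rel (Δ i.castSucc) (Δ i.succ)) ∧
      (Γ.IsConnected → ∀ i, (Δ i).IsConnected) := by
  induction w generalizing Γ with
  | nil => exact ⟨fun _ => Γ, rfl, h, fun i => i.elim0, fun hΓ _ => hΓ⟩
  | cons s w ih =>
    obtain ⟨Γ₁, hs, hw⟩ := h
    obtain ⟨Δ, rfl, hlast, hrel, hconnected⟩ := ih hw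
    refine ⟨Fin.cons Γ Δ, rfl, hlast, Fin.cases hs hrel, fun hΓ => Fin.cases hΓ ?_⟩
    exact hconnected ((Step.isConnected_iff hs).1 hΓ)

end MovePath

/-! ### Derivations between pictures -/

/-- In every exterior, the word `w` leads from the picture `D` to the picture `D'`. -/
def Picture.Derives (w : List Step) {n c c' : ℕ} (D : Picture n c) (D' : Picture n c') : Prop :=
  ∀ (W : Type) (σ : W → ℤˣ) (ctx : Equiv.Perm ((W × Level) ⊕ Fin n)) (Γ Γ' : NormalOGraph),
    Γ.Realizes D σ ctx → Γ'.Realizes D' σ ctx → MovePath w Γ Γ'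

namespace Picture.Derives

variable {n c c' c'' m : ℕ} {D : Picture n c} {D' : Picture n c'} {D'' : Picture n c''}
  {w w' : List Step}

theorem trans (hD' : IsPartition D'.strand) (h : D.Derives w D') (h' : D'.Derives w' D'') :
    D.Derives (w ++ w') D'' := by
  intro W σ ctx Γ Γ'' hΓ hΓ''
  have := hΓ.finite
  obtain ⟨Γ', hΓ'⟩ := Picture.exists_realizes hD' σ ctx
  exact (h W σ ctx Γ Γ' hΓ hΓ').append (h' W σ ctx Γ' Γ'' hΓ' hΓ'')

theorem symm (h : D.Derives w D') : D'.Derives (inverseWord w) D :=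
  fun W σ ctx Γ Γ' hΓ hΓ' => (h W σ ctx Γ' Γ hΓ' hΓ).symm

theorem primary : primaryMP.before.Derives [.forward .primary] primaryMP.after :=
  fun W σ ctx _ Γ' hΓ hΓ' => ⟨Γ', ⟨W, σ, ctx, hΓ, hΓ'⟩, rfl⟩

theorem slide (hD : IsPartition D.strand) {t : PSType} {a b : HalfEdge (Fin c)}
    (hab : D.JoinsViaInnerEdge (a, t.lines.1) (b, t.lines.2)) :
    D.Derives [.forward (.slide t)] (D.slide t a b) :=
  fun _ _ _ _ Γ' hΓ hΓ' => ⟨Γ', t.rel_of_realizes_slide hD hab hΓ hΓ', rfl⟩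

theorem of_isFill {M : LocalMove} (hM : M.before.Derives w M.after) {T : Template n m 3}
    {e : Fin m ⊕ Fin 2 → Fin c} {e' : Fin m ⊕ Fin 3 → Fin c'} (hT : IsPartition T.strand)
    (hD : T.IsFill M.before D e) (hD' : T.IsFill M.after D' e') : D.Derives w D' := by
  intro W σ ctx Γ Γ' hΓ hΓ'
  exact hM _ _ _ Γ Γ' (hΓ.of_isFill hT hD) (hΓ'.of_isFill hT hD')

end Picture.Derives

/-- The local move `M` is a sequence of generating moves, the same in every exterior. -/
def LocalMove.Generated (M : LocalMove) : Prop :=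
  ∃ w, M.before.Derives w M.after

namespace LocalMove.Generated

variable {M N : LocalMove}

theorem rel_path (hM : M.Generated) : ∃ w, ∀ Γ Γ', M.Rel Γ Γ' → MovePath w Γ Γ' := by
  obtain ⟨w, hw⟩ := hM
  exact ⟨w, fun Γ Γ' ⟨W, σ, ctx, h, h'⟩ => hw W σ ctx Γ Γ' h h'⟩

theorem primaryMP : primaryMP.Generated :=
  ⟨_, .primary⟩

theorem of_isFill {m : ℕ} (hN : N.Generated) (T : Template 3 m 3) (e : Fin m ⊕ Fin 2 → Fin 2)
    (e' : Fin m ⊕ Fin 3 → Fin 3) (hT : IsPartition T.strand := by decide)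
    (he : T.IsFill N.before M.before e := by decide)
    (he' : T.IsFill N.after M.after e' := by decide) : M.Generated :=
  hN.imp fun _ hw => hw.of_isFill hT he he'

theorem of_slide_of_inverse {m : ℕ} (hN : N.Generated) (t : PSType) (a b : HalfEdge (Fin 2))
    (T : Template 3 m 3) (e : Fin m ⊕ Fin 3 → Fin 4) (e' : Fin m ⊕ Fin 2 → Fin 3)
    (hM : IsPartition M.before.strand := by decide)
    (hab : M.before.JoinsViaInnerEdge (a, t.lines.1) (b, t.lines.2) := by decide)
    (hslide : IsPartition (M.before.slide t a b).strand := by decide)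
    (hT : IsPartition T.strand := by decide)
    (he : T.IsFill N.after (M.before.slide t a b) e := by decide)
    (he' : T.IsFill N.before M.after e' := by decide) : M.Generated := by
  obtain ⟨w, hw⟩ := hN
  exact ⟨_, (Picture.Derives.slide hM hab).trans hslide (hw.of_isFill hT he' he).symm⟩

theorem of_slide_of_move_of_slide {m : ℕ} (hN : N.Generated) (t : PSType)
    (a b : HalfEdge (Fin 2)) (t' : PSType) (a' b' : HalfEdge (Fin 3)) (T : Template 3 m 3)
    (e : Fin m ⊕ Fin 2 → Fin 4) (e' : Fin m ⊕ Fin 3 → Fin 5)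
    (hM : IsPartition M.before.strand := by decide)
    (hM' : IsPartition M.after.strand := by decide)
    (hab : M.before.JoinsViaInnerEdge (a, t.lines.1) (b, t.lines.2) := by decide)
    (hab' : M.after.JoinsViaInnerEdge (a', t'.lines.1) (b', t'.lines.2) := by decide)
    (hslide : IsPartition (M.before.slide t a b).strand := by decide)
    (hslide' : IsPartition (M.after.slide t' a' b').strand := by decide)
    (hT : IsPartition T.strand := by decide)
    (he : T.IsFill N.before (M.before.slide t a b) e := by decide)
    (he' : T.IsFill N.after (M.after.slide t' a' b') e' := by decide) : M.Generated := by
  obtain ⟨w, hw⟩ := hN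
  exact ⟨_, ((Picture.Derives.slide hM hab).trans hslide (hw.of_isFill hT he he')).trans hslide'
    (Picture.Derives.slide hM' hab').symm⟩

end LocalMove.Generated

/-! ### The 16 MP moves -/

namespace MPType

open Level

theorem generated_D2 : (move D2).Generated :=
  .of_isFill .primaryMP
    (T := ⟨![], ![[.inr 2], [.inr 1], [.inr 0]]⟩)
    (e := Sum.elim ![] ![0, 1]) (e' := Sum.elim ![] ![0, 1, 2])

theorem generated_A1 : (move A1).Generated :=
  .of_slide_of_inverse .primaryMP
    (t := .I) (a := leaving (1, lower)) (b := leaving (0, lower))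
    (T := ⟨![-1], ![[.inr 2, .inl (0, lower)], [.inr 0], [.inr 1, .inl (0, upper)]]⟩)
    (e := Sum.elim ![3] ![1, 0, 2]) (e' := Sum.elim ![2] ![1, 0])

theorem generated_A2 : (move A2).Generated :=
  .of_slide_of_move_of_slide .primaryMP
    (t := .IV) (a := arriving (1, lower)) (b := leaving (0, lower))
    (t' := .III) (a' := leaving (0, upper)) (b' := arriving (2, lower))
    (T := ⟨![-1, -1],
      ![[.inl (0, lower), .inr 2, .inl (1, lower)],
        [.inr 0, .inl (0, upper)],
        [.inl (1, upper), .inr 1]]⟩)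
    (e := Sum.elim ![0, 2] ![3, 1]) (e' := Sum.elim ![4, 1] ![0, 3, 2])

theorem generated_B3 : (move B3).Generated :=
  .of_slide_of_inverse .primaryMP
    (t := .II) (a := arriving (1, upper)) (b := arriving (0, upper))
    (T := ⟨![-1], ![[.inl (0, upper), .inr 0], [.inr 2], [.inl (0, lower), .inr 1]]⟩)
    (e := Sum.elim ![2] ![3, 0, 1]) (e' := Sum.elim ![1] ![0, 2])

theorem generated_B4 : (move B4).Generated :=
  .of_slide_of_move_of_slide .primaryMP
    (t := .IV) (a := arriving (0, upper)) (b := leaving (1, upper))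
    (t' := .III) (a' := leaving (1, upper)) (b' := arriving (0, lower))
    (T := ⟨![-1, -1],
      ![[.inl (1, upper), .inr 0, .inl (0, upper)],
        [.inl (0, lower), .inr 2],
        [.inr 1, .inl (1, lower)]]⟩)
    (e := Sum.elim ![0, 2] ![1, 3]) (e' := Sum.elim ![4, 2] ![1, 3, 0])

theorem generated_B1 : (move B1).Generated :=
  .of_slide_of_move_of_slide generated_A2
    (t := .II) (a := arriving (1, upper)) (b := arriving (0, upper))
    (t' := .III) (a' := leaving (2, lower)) (b' := arriving (0, lower))
    (T := ⟨![-1, -1],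
      ![[.inl (1, upper), .inr 1],
        [.inl (0, lower), .inr 0],
        [.inl (1, lower), .inr 2, .inl (0, upper)]]⟩)
    (e := Sum.elim ![1, 2] ![0, 3]) (e' := Sum.elim ![4, 1] ![2, 0, 3])

theorem generated_B2 : (move B2).Generated :=
  .of_slide_of_move_of_slide generated_A1
    (t := .IV) (a := arriving (0, upper)) (b := leaving (1, upper))
    (t' := .II) (a' := arriving (0, lower)) (b' := arriving (1, lower))
    (T := ⟨![-1, -1],
      ![[.inl (1, upper), .inr 1],
        [.inl (0, lower), .inr 0],
        [.inl (0, upper), .inr 2, .inl (1, lower)]]⟩)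
    (e := Sum.elim ![1, 2] ![0, 3]) (e' := Sum.elim ![3, 2] ![1, 4, 0])

theorem generated_C1 : (move C1).Generated :=
  .of_slide_of_inverse generated_B3
    (t := .I) (a := leaving (1, upper)) (b := leaving (0, upper))
    (T := ⟨![-1], ![[.inr 1], [.inr 2, .inl (0, lower)], [.inr 0, .inl (0, upper)]]⟩)
    (e := Sum.elim ![3] ![0, 1, 2]) (e' := Sum.elim ![0] ![1, 2])

theorem generated_C2 : (move C2).Generated :=
  .of_slide_of_inverse generated_B1
    (t := .I) (a := leaving (1, upper)) (b := leaving (0, upper))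
    (T := ⟨![-1], ![[.inr 1], [.inr 2, .inl (0, lower)], [.inr 0, .inl (0, upper)]]⟩)
    (e := Sum.elim ![3] ![0, 1, 2]) (e' := Sum.elim ![0] ![1, 2])

theorem generated_C3 : (move C3).Generated :=
  .of_slide_of_inverse .primaryMP
    (t := .III) (a := leaving (1, upper)) (b := arriving (0, lower))
    (T := ⟨![-1], ![[.inl (0, lower), .inr 2], [.inr 1], [.inr 0, .inl (0, upper)]]⟩)
    (e := Sum.elim ![3] ![1, 2, 0]) (e' := Sum.elim ![1] ![2, 0])

theorem generated_C4 : (move C4).Generated :=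
  .of_slide_of_inverse generated_A1
    (t := .II) (a := arriving (0, lower)) (b := arriving (1, lower))
    (T := ⟨![-1], ![[.inl (0, lower), .inr 0], [.inl (0, upper), .inr 2], [.inr 1]]⟩)
    (e := Sum.elim ![2] ![1, 3, 0]) (e' := Sum.elim ![2] ![1, 0])

theorem generated_D1 : (move D1).Generated :=
  .of_slide_of_inverse generated_A2
    (t := .III) (a := leaving (1, lower)) (b := arriving (0, lower))
    (T := ⟨![-1], ![[.inl (0, lower), .inr 0], [.inr 2, .inl (0, upper)], [.inr 1]]⟩)
    (e := Sum.elim ![3] ![1, 0, 2]) (e' := Sum.elim ![2] ![1, 0])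

theorem generated_D3 : (move D3).Generated :=
  .of_slide_of_inverse generated_B2
    (t := .III) (a := leaving (1, upper)) (b := arriving (0, upper))
    (T := ⟨![-1], ![[.inr 1], [.inl (0, lower), .inr 2], [.inr 0, .inl (0, upper)]]⟩)
    (e := Sum.elim ![3] ![0, 2, 1]) (e' := Sum.elim ![0] ![1, 2])

theorem generated_D4 : (move D4).Generated :=
  .of_slide_of_inverse generated_B4
    (t := .III) (a := leaving (1, upper)) (b := arriving (0, upper))
    (T := ⟨![-1], ![[.inr 1], [.inl (0, lower), .inr 2], [.inr 0, .inl (0, upper)]]⟩)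
    (e := Sum.elim ![3] ![0, 2, 1]) (e' := Sum.elim ![0] ![1, 2])

theorem generated_A3 : (move A3).Generated :=
  .of_slide_of_inverse generated_C2
    (t := .I) (a := arriving (1, lower)) (b := arriving (0, lower))
    (T := ⟨![1], ![[.inl (0, lower), .inr 0], [.inr 2], [.inl (0, upper), .inr 1]]⟩)
    (e := Sum.elim ![2] ![1, 0, 3]) (e' := Sum.elim ![1] ![2, 0])

theorem generated_A4 : (move A4).Generated :=
  .of_slide_of_inverse generated_C1
    (t := .IV) (a := arriving (1, lower)) (b := leaving (0, lower))
    (T := ⟨![-1], ![[.inr 0, .inl (0, lower)], [.inr 2], [.inl (0, upper), .inr 1]]⟩)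
    (e := Sum.elim ![2] ![1, 0, 3]) (e' := Sum.elim ![1] ![2, 0])

theorem generated : ∀ m : MPType, m.move.Generated
  | A1 => generated_A1
  | A2 => generated_A2
  | A3 => generated_A3
  | A4 => generated_A4
  | B1 => generated_B1
  | B2 => generated_B2
  | B3 => generated_B3
  | B4 => generated_B4
  | C1 => generated_C1
  | C2 => generated_C2
  | C3 => generated_C3
  | C4 => generated_C4
  | D1 => generated_D1
  | D2 => generated_D2
  | D3 => generated_D3
  | D4 => generated_D4

end MPType

theorem mainTheorem1 (m : MPType) :
    ∃ w : List Step, ∀ Γ Γ' : NormalOGraph, m.move.Rel Γ Γ' →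
      ∃ Δ : Fin (w.length + 1) → NormalOGraph,
        Δ 0 = Γ ∧ Δ (Fin.last w.length) = Γ' ∧
        (∀ i : Fin w.length, (w.get i).Rel (Δ i.castSucc) (Δ i.succ)) ∧
        (Γ.IsConnected → ∀ i, (Δ i).IsConnected) := by
  obtain ⟨w, hw⟩ := m.generated.rel_path
  exact ⟨w, fun Γ Γ' h => (hw Γ Γ' h).exists_sequence⟩
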